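/- \textbf{Definitions.} All graphs are finite, simple and undirected, and all logarithms are to one fixed base (natural, say). For a graph $G$ with vertex set $V$ put $d(v,v')=0$ if $v=v'$, $d(v,v')=1$ if $\{v,v'\}\in E(G)$, and $d(v,v')=\infty$ otherwise, and for $x,x'\in V^n$ put $d(x,x')=\sum_{j=1}^n d(x_j,x'_j)$. For real $d\ge 0$ let $G(n,d)$ be the graph with vertex set $V^n$ in which two distinct words $x\neq x'$ are adjacent iff $d(x,x')\le d$. For $\delta\ge 0$ let $$R^*(G,\delta)=\limsup_{n\to\infty}\frac1n\log\alpha(G(n,\delta n)),$$ where $\alpha$ denotes the independence number. Let $\theta_L(G)$ be the Lovász theta function, $$\theta_L(G)=\min\Bigl\{\max_{v}T_{v,v}\ :\ T\in\mathbb R^{V\times V}\text{ symmetric},\ T-\mathbf 1\mathbf 1^{T}\succeq 0,\ T_{v,v'}=0\text{ whenever } v\ne v'\text{ and }\{v,v'\}\notin E(G)\Bigr\}.$$ For real $q>1$ let $$H_q(x)=x\log(q-1)-x\log x-(1-x)\log(1-x)\qquad(0\le x\le 1,\ 0\log 0=0),$$ and for real $q\ge 2$ and $\delta\ge0$ let $$R_{LP1}(q,\delta)=\begin{cases}H_q\!\left(\dfrac{(q-1)-(q-2)\delta-2\sqrt{(q-1)\delta(1-\delta)}}{q}\right)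 & \text{if } \delta<1-\frac1q,\\[2mm] 0 & \text{if }\delta\ge 1-\frac1q.\end{cases}$$ A graph is vertex-transitive (edge-transitive) if its automorphism group acts transitively on its vertices (on its edges). \textbf{Theorem.} Let $G$ be a vertex-transitive and edge-transitive graph with at least one edge. Then for every real $\delta\ge 0$ $$R^*(G,\delta)\ \le\ \log\theta_L(G)+R_{LP1}\!\left(\frac{|V(G)|}{\theta_L(G)},\,\delta\right).$$ (Here $|V(G)|/\theta_L(G)\ge 2$, and it need not be an integer.) -/

import Mathlib

open scoped ENNReal

namespace GraphRate

variable {V : Type*}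

/-- The automorphism group of `G` acts transitively on the vertices. -/
def VertexTransitive (G : SimpleGraph V) : Prop :=
  ∀ u v : V, ∃ φ : G ≃g G, φ u = v

/-- The automorphism group of `G` acts transitively on the (unordered) edges. -/
def EdgeTransitive (G : SimpleGraph V) : Prop :=
  ∀ e ∈ G.edgeSet, ∀ f ∈ G.edgeSet, ∃ φ : G ≃g G, Sym2.map φ e = f

open Classical in
/-- The semimetric on the vertices: `0` on the diagonal, `1` on edges, `∞` otherwise. -/
noncomputable def vertexDist (G : SimpleGraph V) (v w : V) : ℝ≥0∞ :=
  if v = w then 0 else if G.Adj v w then 1 else ∞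

/-- The additive extension of the semimetric to words of length `n`. -/
noncomputable def wordDist (G : SimpleGraph V) {n : ℕ} (x y : Fin n → V) : ℝ≥0∞ :=
  ∑ j, vertexDist G (x j) (y j)

theorem vertexDist_comm (G : SimpleGraph V) (v w : V) :
    vertexDist G v w = vertexDist G w v := by
  by_cases h : v = w
  · rw [h]
  · by_cases hadj : G.Adj v w
    · simp [vertexDist, h, Ne.symm h, hadj, hadj.symm]
    · simp [vertexDist, h, Ne.symm h, hadj, mt SimpleGraph.Adj.symm hadj]

theorem wordDist_comm (G : SimpleGraph V) {n : ℕ} (x y : Fin n → V) :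
    wordDist G x y = wordDist G y x := by
  simp only [wordDist]
  exact Finset.sum_congr rfl fun j _ => vertexDist_comm G _ _

/-- The graph `G(n,d)` on words of length `n`: two distinct words are adjacent iff their
distance is at most the real number `d`. (Distinct words have distance at least `1`, so the
truncation of a negative `d` to `0` is immaterial: both give the empty graph.) -/
noncomputable def powerGraph (G : SimpleGraph V) (n : ℕ) (d : ℝ) : SimpleGraph (Fin n → V) where
  Adj x y := x ≠ y ∧ wordDist G x y ≤ ENNReal.ofReal d
  symm := ⟨fun x y h => ⟨h.1.symm, wordDist_comm G x y ▸ h.2⟩⟩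
  loopless := ⟨fun _ h => h.1 rfl⟩

/-- `R*(G,δ) = limsup_n (1/n) log α(G(n,δn))`. For a nonempty finite vertex set the sequence
takes values in `[0, log |V|]`, so this is the genuine limit superior. -/
noncomputable def rate (G : SimpleGraph V) (δ : ℝ) : ℝ :=
  Filter.limsup
    (fun n : ℕ => (1 / (n : ℝ)) * Real.log ((powerGraph G n (δ * n)).indepNum : ℝ)) Filter.atTop

/-- The Lovász theta function: the minimum of the largest diagonal entry of `T` over all real
symmetric matrices `T` with `T - 𝟏𝟏ᵀ` positive semidefinite and `T v w = 0` for every pair of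
distinct non-adjacent vertices. -/
noncomputable def lovaszTheta [Fintype V] (G : SimpleGraph V) : ℝ :=
  sInf {t : ℝ | ∃ T : Matrix V V ℝ,
    (T - Matrix.of fun _ _ => (1 : ℝ)).PosSemidef ∧
    (∀ v w, v ≠ w → ¬ G.Adj v w → T v w = 0) ∧
    t = ⨆ v, T v v}

/-- The `q`-ary entropy function with a real parameter `q`. -/
noncomputable def entropyQ (q x : ℝ) : ℝ :=
  x * Real.log (q - 1) - x * Real.log x - (1 - x) * Real.log (1 - x)

/-- The first linear-programming bound with a real parameter `q`. -/
noncomputable def rateLP1 (q δ : ℝ) : ℝ :=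
  if δ < 1 - 1 / q then
    entropyQ q (((q - 1) - (q - 2) * δ - 2 * √((q - 1) * δ * (1 - δ))) / q)
  else 0

end GraphRate

/-!
The bound is Delsarte's linear programming method with the first linear programming test function,
carried out over the alphabet size `q = |V| / θ`, which is real and at least `2` but need not be an
integer.

**The role of the theta function.** Let `A` be the adjacency matrix, `k` the degree and `-τ` the
least eigenvalue. Averaging a feasible matrix over the automorphism group leaves only matrices of
the form `a I + b A`, so `θ = |V| τ / (k + τ)`, attained by `θ W` with `W = I + A / τ`
(`exists_extremal_matrix`). Hence `W - θ⁻¹ J`, with `J` the all-ones matrix, and `q I - W` are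
positive semidefinite. For the complete graph these are the two idempotents of the Hamming scheme
up to scaling; in general they replace them, and `q ≥ 2` because `τ ≤ k`.

**The linear programming bound.** For words `x, y` put `κ_i = q - 1` if `x_i = y_i` and `κ_i = -1`
otherwise. The kernel `∏ W(x_i, y_i)` is nonnegative, equals `1` on the diagonal, and vanishes at
infinite distance. Multiplying it by `∏_{i ∈ S} κ_i * ∏_{i ∈ T} κ_i` gives a tensor product of the
matrices `W`, `q I - W` and `q (q - 2) I + W`, all positive semidefinite since `q ≥ 2`; for `S = T`
every factor dominates a multiple of `J` (`card_sq_le_sum_weight_mul_char_sq`). Take the function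
`f = (∑ κ_i - λ) (∑_S g(|S|) ∏_{i ∈ S} κ_i) ^ 2`, whose first factor is nonpositive beyond the
minimum distance `d` when `λ = n (q - 1) - q d`. If `g` is nonnegative, supported on `[0, r]`, and
satisfies `K g ≥ (λ + 1) g` for the radial adjacency operator `K`, then summing `f` times the kernel
over the pairs of codewords and using Cauchy-Schwarz gives `|C| ≤ θ ^ n * q d * Vol(r)`
(`card_le_of_radialAdj_ge`). No Krawtchouk polynomials are needed.

**Asymptotics.** A geometrically rescaled sine wave on a window of constant length just below
`r = ρ n` is such a `g` as soon as `2 √((q - 1) ρ (1 - ρ)) + (q - 2) ρ > q - 1 - q δ`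
(`exists_radialAdj_ge`, `eventually_window`). The radius `ρ = lpRadius q δ'` satisfies this for every
`δ' < δ` below `1 - 1 / q`, with equality for `δ' = δ` (`lpRadius_spec`), and
`Vol(ρ n) ≤ exp (n H_q(ρ))`. Letting `δ'` increase to `min δ (1 - 1 / q)` gives the theorem for
`δ > 0`; for `δ = 0` it is the trivial bound `log |V|`.
-/

namespace GraphRate

open Finset

/-! ### Sums of products of positive semidefinite kernels -/

theorem exists_gram {V : Type*} [Fintype V] [DecidableEq V] {M : Matrix V V ℝ}
    (hM : M.PosSemidef) : ∃ R : V → V → ℝ, ∀ v w, M v w = ∑ k, R k v * R k w := by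
  open scoped MatrixOrder in
  obtain ⟨B, rfl⟩ := CStarAlgebra.nonneg_iff_eq_star_mul_self.mp hM.nonneg
  exact ⟨B, fun v w => by simp [Matrix.mul_apply, Matrix.star_apply]⟩

/-- Tensor products of positive semidefinite matrices, each dominating a multiple of the all-ones
matrix, dominate the corresponding multiple of the all-ones matrix; the statement is the resulting
inequality for the indicator vector of a set of words. -/
theorem prod_mul_card_sq_le_sum_prod {V : Type*} [Fintype V] [DecidableEq V] {n : ℕ}
    (M : Fin n → Matrix V V ℝ) (c : Fin n → ℝ) (hc : ∀ i, 0 ≤ c i)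
    (hM : ∀ i, (M i - Matrix.of fun _ _ => c i).PosSemidef) (C : Finset (Fin n → V)) :
    (∏ i, c i) * (#C : ℝ) ^ 2 ≤ ∑ x ∈ C, ∑ y ∈ C, ∏ i, M i (x i) (y i) := by
  choose R hR using fun i => exists_gram (hM i)
  -- The extra index `none` carries the constant vector `√c` of the Gram representation.
  let R' : Fin n → Option V → V → ℝ := fun i o v => o.elim √(c i) (fun k => R i k v)
  have hR' : ∀ i v w, M i v w = ∑ o, R' i o v * R' i o w := by
    intro i v w
    have h := hR i v w
    simp only [Matrix.sub_apply, Matrix.of_apply] at h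
    rw [Fintype.sum_option]
    simp only [R', Option.elim]
    rw [Real.mul_self_sqrt (hc i), ← h]
    ring
  have key : ∑ x ∈ C, ∑ y ∈ C, ∏ i, M i (x i) (y i)
      = ∑ o : Fin n → Option V, (∑ x ∈ C, ∏ i, R' i (o i) (x i)) ^ 2 := by
    simp only [hR', prod_univ_sum, Fintype.piFinset_univ, prod_mul_distrib, sq, sum_mul_sum]
    exact (sum_congr rfl fun x _ => sum_comm).trans sum_comm
  rw [key]
  refine le_trans (le_of_eq ?_)
    (single_le_sum (f := fun o : Fin n → Option V => (∑ x ∈ C, ∏ i, R' i (o i) (x i)) ^ 2)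
      (fun o _ => sq_nonneg _) (mem_univ fun _ => none))
  simp only [R', Option.elim, sum_const, nsmul_eq_mul, mul_pow, ← prod_pow]
  rw [mul_comm]
  congr 1
  exact prod_congr rfl fun i _ => (Real.sq_sqrt (hc i)).symm

/-! ### The linear programming bound with real alphabet parameter -/

/-- The coefficients of the product of `∑ i, κ i` with `∑ S, g #S * ∏ i ∈ S, κ i`, where each `κ i`
satisfies `κ i ^ 2 = (q - 1) + (q - 2) * κ i`. For integral `q` this is the adjacency operator of
the `q`-ary Hamming graph acting on radial functions. -/
noncomputable def radialAdj (q : ℝ) (n : ℕ) (g : ℕ → ℝ) (t : ℕ) : ℝ :=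
  t * g (t - 1) + (n - t) * (q - 1) * g (t + 1) + t * (q - 2) * g t

theorem sum_finset_eq_sum_erase {ι : Type*} [Fintype ι] [DecidableEq ι] (i : ι)
    (F : Finset ι → ℝ) :
    ∑ S : Finset ι, F S = ∑ S ∈ (univ.erase i).powerset, (F S + F (insert i S)) := by
  rw [sum_add_distrib, ← sum_powerset_insert (notMem_erase i univ), insert_erase (mem_univ i),
    powerset_univ]

theorem sum_mul_radial {n : ℕ} (q : ℝ) (κ : Fin n → ℝ)
    (hκ : ∀ i, κ i ^ 2 = (q - 1) + (q - 2) * κ i) (g : ℕ → ℝ) :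
    (∑ i, κ i) * ∑ S : Finset (Fin n), g #S * ∏ i ∈ S, κ i
      = ∑ S : Finset (Fin n), radialAdj q n g #S * ∏ i ∈ S, κ i := by
  have h1 : ∀ i, κ i * ∑ S : Finset (Fin n), g #S * ∏ j ∈ S, κ j
      = ∑ S : Finset (Fin n), (if i ∈ S then g (#S - 1) + (q - 2) * g #S
          else (q - 1) * g (#S + 1)) * ∏ j ∈ S, κ j := by
    intro i
    rw [mul_sum, sum_finset_eq_sum_erase i, sum_finset_eq_sum_erase i]
    refine sum_congr rfl fun S hS => ?_
    have hi : i ∉ S := fun h => notMem_erase i univ (mem_powerset.1 hS h)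
    rw [prod_insert hi, card_insert_of_notMem hi]
    simp only [hi, if_false, mem_insert_self, if_true, Nat.add_sub_cancel]
    linear_combination (g (#S + 1) * ∏ j ∈ S, κ j) * hκ i
  rw [sum_mul, sum_congr rfl fun i _ => h1 i, sum_comm]
  refine sum_congr rfl fun S _ => ?_
  rw [← sum_mul]
  congr 1
  rw [sum_ite, sum_const, sum_const]
  have e1 : univ.filter (· ∈ S) = S := by ext; simp
  have e2 : univ.filter (· ∉ S) = Sᶜ := by ext; simp
  rw [e1, e2, card_compl, Fintype.card_fin, nsmul_eq_mul, nsmul_eq_mul,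
    Nat.cast_sub (by simpa using card_le_univ S), radialAdj]
  ring

/-- The `i`-th coordinate character: `q - 1` where two words agree, `-1` where they differ. -/
noncomputable def coordChar {V : Type*} [DecidableEq V] {n : ℕ} (q : ℝ) (x y : Fin n → V)
    (i : Fin n) : ℝ :=
  if x i = y i then q - 1 else -1

theorem coordChar_sq {V : Type*} [DecidableEq V] {n : ℕ} (q : ℝ) (x y : Fin n → V) (i : Fin n) :
    coordChar q x y i ^ 2 = (q - 1) + (q - 2) * coordChar q x y i := by
  unfold coordChar
  split_ifs <;> ring

theorem sum_coordChar {V : Type*} [DecidableEq V] {n : ℕ} (q : ℝ) (x y : Fin n → V) :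
    ∑ i, coordChar q x y i = n * (q - 1) - q * hammingDist x y := by
  have h : ∀ i, coordChar q x y i = (q - 1) - q * (if x i ≠ y i then 1 else 0) := by
    intro i
    unfold coordChar
    by_cases h : x i = y i <;> simp [h]
  simp only [h, sum_sub_distrib, ← mul_sum, sum_boole, hammingDist]
  simp [mul_sub]

/-- The weighted size `∑ (q - 1) ^ #S` over `#S ≤ r`, which is the cardinality of the Hamming ball of
radius `r` when `q` is an integer. -/
noncomputable def ballVolume (q : ℝ) (n r : ℕ) : ℝ :=
  ∑ S : Finset (Fin n) with #S ≤ r, (q - 1) ^ #S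

section KernelBound

variable {V : Type*} [DecidableEq V] {q θ : ℝ} {W : Matrix V V ℝ} {n : ℕ}

theorem prod_weight_mul_char_mul_char (x y : Fin n → V) (S T : Finset (Fin n))
    (hdiag : ∀ v, W v v = 1) :
    (∏ i, W (x i) (y i)) * ((∏ i ∈ S, coordChar q x y i) * ∏ i ∈ T, coordChar q x y i)
      = ∏ i, (if i ∈ S then (if i ∈ T then (q * (q - 2)) • (1 : Matrix V V ℝ) + W
          else q • 1 - W) else (if i ∈ T then q • 1 - W else W)) (x i) (y i) := by
  rw [← prod_ite_mem_eq S, ← prod_ite_mem_eq T, ← prod_mul_distrib, ← prod_mul_distrib]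
  refine prod_congr rfl fun i _ => ?_
  unfold coordChar
  by_cases hxy : x i = y i
  · by_cases hS : i ∈ S <;> by_cases hT : i ∈ T <;> simp [hS, hT, hxy, hdiag]
    ring
  · by_cases hS : i ∈ S <;> by_cases hT : i ∈ T <;> simp [hS, hT, hxy]

variable [Fintype V]

theorem sum_weight_mul_char_nonneg (hq : 2 ≤ q) (hdiag : ∀ v, W v v = 1) (hW : W.PosSemidef)
    (hqW : (q • (1 : Matrix V V ℝ) - W).PosSemidef)
    (C : Finset (Fin n → V)) (S T : Finset (Fin n)) :
    0 ≤ ∑ x ∈ C, ∑ y ∈ C, (∏ i, W (x i) (y i)) *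
      ((∏ i ∈ S, coordChar q x y i) * ∏ i ∈ T, coordChar q x y i) := by
  simp only [prod_weight_mul_char_mul_char _ _ S T hdiag]
  refine le_trans ?_ (prod_mul_card_sq_le_sum_prod _ (fun _ => 0) (fun _ => le_rfl) ?_ C)
  · positivity
  · intro i
    have h0 : (Matrix.of fun _ _ => (0 : ℝ)) = (0 : Matrix V V ℝ) := rfl
    rw [h0, sub_zero]
    split_ifs
    · exact (Matrix.PosSemidef.one.smul (by nlinarith)).add hW
    · exact hqW
    · exact hqW
    · exact hW

theorem card_sq_le_sum_weight_mul_char_sq (hq : 2 ≤ q) (hθ : 0 < θ) (hdiag : ∀ v, W v v = 1)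
    (hW : (W - Matrix.of fun _ _ => θ⁻¹).PosSemidef)
    (hqW : (q • (1 : Matrix V V ℝ) - W).PosSemidef)
    (C : Finset (Fin n → V)) (S : Finset (Fin n)) :
    (q - 1) ^ #S * (θ⁻¹ ^ n * (#C : ℝ) ^ 2) ≤ ∑ x ∈ C, ∑ y ∈ C, (∏ i, W (x i) (y i)) *
      ((∏ i ∈ S, coordChar q x y i) * ∏ i ∈ S, coordChar q x y i) := by
  simp only [prod_weight_mul_char_mul_char _ _ S S hdiag]
  refine le_trans (le_of_eq ?_) (prod_mul_card_sq_le_sum_prod _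
    (fun i => (if i ∈ S then q - 1 else 1) * θ⁻¹) (fun i => ?_) ?_ C)
  · rw [prod_mul_distrib, prod_ite_mem_eq S fun _ => q - 1]
    simp [mul_assoc]
  · have : 0 ≤ θ⁻¹ := by positivity
    split_ifs
    · exact mul_nonneg (by linarith) this
    · linarith
  · intro i
    by_cases hi : i ∈ S
    · simp only [hi, if_true]
      have e : (q * (q - 2)) • (1 : Matrix V V ℝ) + W - Matrix.of (fun _ _ => (q - 1) * θ⁻¹)
          = (q - 1) • (W - Matrix.of fun _ _ => θ⁻¹) + (q - 2) • (q • (1 : Matrix V V ℝ) - W) := by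
        ext v w
        by_cases hvw : v = w <;> simp [hvw] <;> ring
      rw [e]
      exact (hW.smul (by linarith)).add (hqW.smul (by linarith))
    · simpa [hi] using hW

/-- The linear programming bound, for the test function
`(∑ i, κ i - λ) * (∑ S, g #S * ∏ i ∈ S, κ i) ^ 2` with `λ = n * (q - 1) - q * d`: any nonnegative
`g` supported on `[0, r]` on which the radial adjacency operator acts with growth at least `λ + 1`
bounds the size of a code of distance `d`. -/
theorem card_le_of_radialAdj_ge (hq : 2 ≤ q) (hθ : 0 < θ) (hdiag : ∀ v, W v v = 1)
    (hnn : ∀ v w, 0 ≤ W v w)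
    (hW : (W - Matrix.of fun _ _ => θ⁻¹).PosSemidef)
    (hqW : (q • (1 : Matrix V V ℝ) - W).PosSemidef)
    (C : Finset (Fin n → V)) {d : ℝ} (hd : 0 ≤ d)
    (hC : ∀ x ∈ C, ∀ y ∈ C, x ≠ y → d ≤ hammingDist x y ∨ ∃ i, W (x i) (y i) = 0)
    {g : ℕ → ℝ} {r : ℕ} (hg : ∀ t, 0 ≤ g t) (hgr : ∀ t, r < t → g t = 0)
    (hpos : ∃ t ≤ n, 0 < g t)
    (hadj : ∀ t ≤ n, (n * (q - 1) - q * d + 1) * g t ≤ radialAdj q n g t) :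
    (#C : ℝ) ≤ θ ^ n * (q * d * ballVolume q n r) := by
  have hW0 : W.PosSemidef := by
    have hJ : (Matrix.of fun _ _ => θ⁻¹ : Matrix V V ℝ).PosSemidef := by
      have := (Matrix.posSemidef_vecMulVec_self_star (fun _ : V => (1 : ℝ))).smul
        (inv_nonneg.2 hθ.le)
      convert this using 1
      ext; simp [Matrix.vecMulVec_apply]
    simpa using hW.add hJ
  set lam : ℝ := n * (q - 1) - q * d with hlam
  set G : (Fin n → V) → (Fin n → V) → ℝ :=
    fun x y => ∑ S : Finset (Fin n), g #S * ∏ i ∈ S, coordChar q x y i with hG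
  set P : (Fin n → V) → (Fin n → V) → ℝ := fun x y => ∏ i, W (x i) (y i) with hP
  set D : ℝ := ∑ S : Finset (Fin n), g #S ^ 2 * (q - 1) ^ #S with hD
  set u : ℕ → ℝ := fun t => radialAdj q n g t - lam * g t with hu
  have hu1 : ∀ S : Finset (Fin n), g #S ≤ u #S := fun S => by
    have := hadj #S (by simpa using card_le_univ S)
    simp only [hu]
    linarith
  have hf : ∀ x y, ((∑ i, coordChar q x y i) - lam) * G x y ^ 2
      = ∑ S : Finset (Fin n), ∑ T : Finset (Fin n), u #S * g #T *
        ((∏ i ∈ S, coordChar q x y i) * ∏ i ∈ T, coordChar q x y i) := by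
    intro x y
    have h1 := sum_mul_radial q (coordChar q x y) (coordChar_sq q x y) g
    have h2 : ((∑ i, coordChar q x y i) - lam) * G x y
        = ∑ S : Finset (Fin n), u #S * ∏ i ∈ S, coordChar q x y i := by
      rw [sub_mul, hG, h1, mul_sum, ← sum_sub_distrib]
      exact sum_congr rfl fun S _ => by simp only [hu]; ring
    rw [sq, ← mul_assoc, h2, hG, sum_mul_sum]
    exact sum_congr rfl fun S _ => sum_congr rfl fun T _ => by ring
  have hlower : D * (θ⁻¹ ^ n * (#C : ℝ) ^ 2)
      ≤ ∑ x ∈ C, ∑ y ∈ C, P x y * (((∑ i, coordChar q x y i) - lam) * G x y ^ 2) := by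
    have e : ∑ x ∈ C, ∑ y ∈ C, P x y * (((∑ i, coordChar q x y i) - lam) * G x y ^ 2)
        = ∑ S : Finset (Fin n), ∑ T : Finset (Fin n), u #S * g #T * ∑ x ∈ C, ∑ y ∈ C, P x y *
          ((∏ i ∈ S, coordChar q x y i) * ∏ i ∈ T, coordChar q x y i) := by
      simp only [hf, mul_sum]
      refine (sum_congr rfl fun x _ => sum_comm).trans ?_
      rw [sum_comm]
      refine sum_congr rfl fun S _ => ?_
      refine (sum_congr rfl fun x _ => sum_comm).trans ?_
      rw [sum_comm]
      exact sum_congr rfl fun T _ => sum_congr rfl fun x _ => sum_congr rfl fun y _ => by ring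
    rw [e, hD, sum_mul]
    refine sum_le_sum fun S _ => ?_
    -- All off-diagonal pairs `(S, T)` contribute nonnegatively; only `T = S` is kept.
    refine le_trans ?_ (single_le_sum (fun T _ => mul_nonneg
      (mul_nonneg ((hg _).trans (hu1 S)) (hg _))
      (sum_weight_mul_char_nonneg hq hdiag hW0 hqW C S T)) (mem_univ S))
    have h3 := card_sq_le_sum_weight_mul_char_sq hq hθ hdiag hW hqW C S
    have h4 : 0 ≤ (q - 1) ^ #S * (θ⁻¹ ^ n * (#C : ℝ) ^ 2) :=
      mul_nonneg (pow_nonneg (by linarith) _) (by positivity)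
    calc g #S ^ 2 * (q - 1) ^ #S * (θ⁻¹ ^ n * (#C : ℝ) ^ 2)
        = g #S * g #S * ((q - 1) ^ #S * (θ⁻¹ ^ n * (#C : ℝ) ^ 2)) := by ring
      _ ≤ u #S * g #S * ((q - 1) ^ #S * (θ⁻¹ ^ n * (#C : ℝ) ^ 2)) :=
        mul_le_mul_of_nonneg_right (mul_le_mul_of_nonneg_right (hu1 S) (hg _)) h4
      _ ≤ _ := mul_le_mul_of_nonneg_left h3 (mul_nonneg ((hg _).trans (hu1 S)) (hg _))
  set G0 : ℝ := ∑ S : Finset (Fin n), g #S * (q - 1) ^ #S with hG0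
  have hupper : ∑ x ∈ C, ∑ y ∈ C, P x y * (((∑ i, coordChar q x y i) - lam) * G x y ^ 2)
      ≤ #C * (q * d * G0 ^ 2) := by
    have hx : ∀ x ∈ C, ∑ y ∈ C, P x y * (((∑ i, coordChar q x y i) - lam) * G x y ^ 2)
        ≤ q * d * G0 ^ 2 := by
      intro x hx
      rw [← add_sum_erase C _ hx]
      have hself : P x x * (((∑ i, coordChar q x x i) - lam) * G x x ^ 2) = q * d * G0 ^ 2 := by
        simp only [sum_coordChar, hP, hG, hdiag, hG0]
        simp [coordChar, hlam]
      rw [hself]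
      refine add_le_of_nonpos_right (sum_nonpos fun y hy => ?_)
      rw [mem_erase] at hy
      rcases hC x hx y hy.2 hy.1.symm with h | ⟨i, hi⟩
      · refine mul_nonpos_of_nonneg_of_nonpos (prod_nonneg fun i _ => hnn _ _)
          (mul_nonpos_of_nonpos_of_nonneg ?_ (sq_nonneg _))
        rw [sum_coordChar, hlam]
        nlinarith
      · rw [hP]
        simp only
        rw [prod_eq_zero (mem_univ i) hi, zero_mul]
    calc _ ≤ ∑ x ∈ C, q * d * G0 ^ 2 := sum_le_sum hx
      _ = _ := by rw [sum_const, nsmul_eq_mul]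
  have hball : G0 ^ 2 ≤ ballVolume q n r * D := by
    have e : G0 = ∑ S : Finset (Fin n) with #S ≤ r, g #S * (q - 1) ^ #S := by
      rw [hG0, sum_filter]
      refine sum_congr rfl fun S _ => ?_
      split_ifs with h
      · rfl
      · rw [hgr _ (not_le.1 h), zero_mul]
    have e2 : D = ∑ S : Finset (Fin n) with #S ≤ r, g #S ^ 2 * (q - 1) ^ #S := by
      rw [hD, sum_filter]
      refine sum_congr rfl fun S _ => ?_
      split_ifs with h
      · rfl
      · rw [hgr _ (not_le.1 h)]; ring
    rw [e, e2, ballVolume]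
    have hq1 : 0 ≤ q - 1 := by linarith
    exact sum_sq_le_sum_mul_sum_of_sq_le_mul _ (fun S _ => by positivity)
      (fun S _ => by positivity) fun S _ => le_of_eq (by ring)
  have hDpos : 0 < D := by
    obtain ⟨t, htn, ht⟩ := hpos
    obtain ⟨S, -, hS⟩ := exists_subset_card_eq (s := (univ : Finset (Fin n))) (n := t)
      (by simpa using htn)
    refine sum_pos' (fun S _ => mul_nonneg (sq_nonneg _) (pow_nonneg (by linarith) _))
      ⟨S, mem_univ S, ?_⟩
    rw [hS]
    have : 0 < q - 1 := by linarith
    positivity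
  rcases (#C).eq_zero_or_pos with h0 | h0
  · have hb : 0 ≤ ballVolume q n r := sum_nonneg fun S _ => pow_nonneg (by linarith) _
    rw [h0]
    have hq0 : 0 ≤ q := by linarith
    rw [Nat.cast_zero]
    exact mul_nonneg (by positivity) (mul_nonneg (mul_nonneg hq0 hd) hb)
  · have h0' : (0 : ℝ) < #C := by exact_mod_cast h0
    have h5 : D * #C * (θ⁻¹ ^ n * #C) ≤ D * #C * (q * d * ballVolume q n r) := by
      calc D * #C * (θ⁻¹ ^ n * #C) = D * (θ⁻¹ ^ n * (#C : ℝ) ^ 2) := by ring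
        _ ≤ #C * (q * d * G0 ^ 2) := hlower.trans hupper
        _ ≤ #C * (q * d * (ballVolume q n r * D)) := by
          have : 0 ≤ q := by linarith
          gcongr
        _ = _ := by ring
    have h6 := le_of_mul_le_mul_left h5 (by positivity)
    rw [inv_pow, inv_mul_le_iff₀ (by positivity)] at h6
    exact h6

end KernelBound

/-! ### Volume of balls and the test vector -/

theorem ballVolume_le_exp_entropyQ {q ρ : ℝ} (hq : 1 < q) (hρ0 : 0 < ρ) (hρ : q * ρ ≤ q - 1)
    {n r : ℕ} (hr : (r : ℝ) ≤ ρ * n) : ballVolume q n r ≤ Real.exp (n * entropyQ q ρ) := by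
  have hρ1 : 0 < 1 - ρ := by nlinarith
  have hq1 : 0 < q - 1 := by linarith
  -- The Chernoff parameter `exp (-ζ) = ρ / ((1 - ρ) (q - 1))` minimises the bound below.
  set ζ : ℝ := Real.log (1 - ρ) + Real.log (q - 1) - Real.log ρ with hζ
  have hζ0 : 0 ≤ ζ := by
    rw [hζ, ← Real.log_mul hρ1.ne' hq1.ne', sub_nonneg]
    exact Real.log_le_log hρ0 (by nlinarith)
  have ha : (q - 1) * Real.exp (-ζ) = ρ / (1 - ρ) := by
    have e : -ζ = Real.log ρ - Real.log (1 - ρ) - Real.log (q - 1) := by rw [hζ]; ring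
    rw [e, Real.exp_sub, Real.exp_sub, Real.exp_log hρ0, Real.exp_log hρ1, Real.exp_log hq1]
    field_simp
  have hterm : ∀ S : Finset (Fin n), #S ≤ r →
      (q - 1) ^ #S ≤ (ρ / (1 - ρ)) ^ #S * Real.exp (ζ * (ρ * n)) := by
    intro S hS
    rw [← ha, mul_pow, mul_assoc, ← Real.exp_nat_mul, ← Real.exp_add]
    refine le_mul_of_one_le_right (by positivity) (Real.one_le_exp ?_)
    have : (#S : ℝ) ≤ ρ * n := le_trans (by exact_mod_cast hS) hr
    nlinarith
  calc ballVolume q n r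
      ≤ ∑ S : Finset (Fin n) with #S ≤ r, (ρ / (1 - ρ)) ^ #S * Real.exp (ζ * (ρ * n)) :=
        sum_le_sum fun S hS => hterm S (mem_filter.1 hS).2
    _ ≤ ∑ S : Finset (Fin n), (ρ / (1 - ρ)) ^ #S * Real.exp (ζ * (ρ * n)) :=
        sum_le_sum_of_subset_of_nonneg (filter_subset _ _) fun S _ _ => by positivity
    _ = (ρ / (1 - ρ) + 1) ^ n * Real.exp (ζ * (ρ * n)) := by
        rw [← sum_mul]
        congr 1
        simpa using Fintype.sum_pow_mul_eq_add_pow (Fin n) (ρ / (1 - ρ)) 1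
    _ = Real.exp (n * entropyQ q ρ) := by
        have e : ρ / (1 - ρ) + 1 = Real.exp (-Real.log (1 - ρ)) := by
          rw [Real.exp_neg, Real.exp_log hρ1]
          field_simp
          ring
        rw [e, ← Real.exp_nat_mul, ← Real.exp_add]
        congr 1
        rw [hζ, entropyQ]
        ring

/-- On the window `l < t ≤ l + m` the coefficients of the radial adjacency operator are at least
those at its ends, so a geometrically rescaled sine wave on the window is an approximate
eigenvector. -/
theorem exists_radialAdj_ge {q : ℝ} (hq : 2 ≤ q) {n l m : ℕ} (hl : 0 < l) (hm : 0 < m)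
    (hn : l + m < n) {c : ℝ}
    (hc : c ≤ 2 * Real.cos (Real.pi / (m + 1)) * √(l * ((n - l - m) * (q - 1))) + l * (q - 2)) :
    ∃ g : ℕ → ℝ, (∀ t, 0 ≤ g t) ∧ (∀ t, l + m < t → g t = 0) ∧ (∃ t ≤ n, 0 < g t) ∧
      ∀ t ≤ n, c * g t ≤ radialAdj q n g t := by
  have hl' : (0 : ℝ) < l := by exact_mod_cast hl
  have hn' : (l : ℝ) + m < n := by exact_mod_cast hn
  have hm' : (0 : ℝ) < m := by exact_mod_cast hm
  set β : ℝ := (n - l - m) * (q - 1) with hβ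
  have hβ0 : 0 < β := mul_pos (by linarith) (by linarith)
  set σ : ℝ := √(l * β) with hσ
  have hσ0 : 0 < σ := Real.sqrt_pos.2 (by positivity)
  have hσ2 : σ ^ 2 = l * β := Real.sq_sqrt (by positivity)
  set a : ℝ := l / σ with ha
  have ha0 : 0 < a := by positivity
  -- This choice of `a` equalises the two neighbour coefficients: `l / a = β * a = σ`.
  have ha1 : σ * a = l := by rw [ha]; field_simp
  have ha2 : β * a = σ := by
    rw [ha]
    field_simp
    linarith
  set φ : ℝ := Real.pi / (m + 1) with hφ
  have hφ0 : 0 < φ := by positivity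
  have hφ1 : φ * (m + 1) = Real.pi := by rw [hφ]; field_simp
  set s : ℕ → ℝ := fun t => Real.sin (φ * ((t : ℝ) - l)) with hs
  have hs0 : ∀ t : ℕ, l ≤ t → t ≤ l + m + 1 → 0 ≤ s t := by
    intro t h1 h2
    have h1' : (l : ℝ) ≤ t := by exact_mod_cast h1
    have h2' : (t : ℝ) ≤ l + m + 1 := by exact_mod_cast h2
    refine Real.sin_nonneg_of_nonneg_of_le_pi (mul_nonneg hφ0.le (by linarith)) ?_
    rw [← hφ1]
    exact mul_le_mul_of_nonneg_left (by linarith) hφ0.le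
  set g : ℕ → ℝ := fun t => if l < t ∧ t ≤ l + m then a ^ t * s t else 0 with hg
  have hg0 : ∀ t, 0 ≤ g t := by
    intro t
    simp only [hg]
    split_ifs with h
    · exact mul_nonneg (by positivity) (hs0 t h.1.le (by omega))
    · exact le_rfl
  -- The sine vanishes at both ends, so the formula for `g` persists one step outside the window.
  have hgs : ∀ t, l ≤ t → t ≤ l + m + 1 → g t = a ^ t * s t := by
    intro t h1 h2
    simp only [hg]
    split_ifs with h
    · rfl
    · have : t = l ∨ t = l + m + 1 := by omega
      rcases this with rfl | rfl
      · simp [hs]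
      · have e : φ * (((l + m + 1 : ℕ) : ℝ) - l) = Real.pi := by
          rw [← hφ1]; push_cast; ring
        simp only [hs, e, Real.sin_pi, mul_zero]
  refine ⟨g, hg0, fun t ht => ?_, ⟨l + 1, by omega, ?_⟩, fun t htn => ?_⟩
  · simp only [hg]
    rw [if_neg (by omega)]
  · rw [hgs _ (by omega) (by omega)]
    refine mul_pos (by positivity) (Real.sin_pos_of_pos_of_lt_pi ?_ ?_)
    · push_cast; simpa using hφ0
    · rw [← hφ1]
      push_cast
      nlinarith
  · have htn' : (t : ℝ) ≤ n := by exact_mod_cast htn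
    by_cases hw : l < t ∧ t ≤ l + m
    · obtain ⟨k, rfl⟩ : ∃ k, t = k + 1 := ⟨t - 1, by omega⟩
      have h1 : (l : ℝ) ≤ (k + 1 : ℕ) := by exact_mod_cast hw.1.le
      have h2 : ((k + 1 : ℕ) : ℝ) ≤ l + m := by exact_mod_cast hw.2
      have e0 := hgs k (by omega) (by omega)
      have e1 := hgs (k + 1) (by omega) (by omega)
      have e2 := hgs (k + 2) (by omega) (by omega)
      have htrig : s k + s (k + 2) = 2 * Real.cos φ * s (k + 1) := by
        have f0 : φ * ((k : ℝ) - l) = φ * (((k + 1 : ℕ) : ℝ) - l) - φ := by push_cast; ring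
        have f2 : φ * (((k + 2 : ℕ) : ℝ) - l) = φ * (((k + 1 : ℕ) : ℝ) - l) + φ := by
          push_cast; ring
        simp only [hs]
        rw [f0, f2, Real.sin_sub, Real.sin_add]
        ring
      have k1 : (l : ℝ) * g k ≤ (k + 1 : ℕ) * g k := mul_le_mul_of_nonneg_right h1 (hg0 _)
      have k2 : β * g (k + 2) ≤ ((n : ℝ) - (k + 1 : ℕ)) * (q - 1) * g (k + 2) :=
        mul_le_mul_of_nonneg_right
          (mul_le_mul_of_nonneg_right (by linarith) (by linarith)) (hg0 _)
      have k3 : (l : ℝ) * (q - 2) * g (k + 1) ≤ (k + 1 : ℕ) * (q - 2) * g (k + 1) :=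
        mul_le_mul_of_nonneg_right (mul_le_mul_of_nonneg_right h1 (by linarith)) (hg0 _)
      have k4 : (l : ℝ) * g k + β * g (k + 2) = 2 * Real.cos φ * σ * g (k + 1) := by
        rw [e0, e1, e2]
        calc (l : ℝ) * (a ^ k * s k) + β * (a ^ (k + 2) * s (k + 2))
            = (σ * a) * (a ^ k * s k) + (β * a) * (a ^ (k + 1) * s (k + 2)) := by rw [ha1]; ring
          _ = σ * a ^ (k + 1) * (s k + s (k + 2)) := by rw [ha2]; ring
          _ = _ := by rw [htrig]; ring
      have k5 := mul_le_mul_of_nonneg_right hc (hg0 (k + 1))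
      rw [radialAdj, Nat.add_sub_cancel]
      linarith
    · have : g t = 0 := by simp only [hg]; rw [if_neg hw]
      rw [radialAdj, this]
      have j1 : 0 ≤ (t : ℝ) * g (t - 1) := mul_nonneg (by positivity) (hg0 _)
      have j2 : 0 ≤ ((n : ℝ) - t) * (q - 1) * g (t + 1) :=
        mul_nonneg (mul_nonneg (by linarith) (by linarith)) (hg0 _)
      linarith

/-! ### The theta function of a vertex- and edge-transitive graph -/

theorem posSemidef_of_sum_nonneg {V : Type*} [Fintype V] {M : Matrix V V ℝ}
    (hs : ∀ v w, M v w = M w v) (h : ∀ x : V → ℝ, 0 ≤ ∑ v, ∑ w, M v w * (x v * x w)) :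
    M.PosSemidef := by
  refine .of_dotProduct_mulVec_nonneg (Matrix.ext fun v w => ?_) fun x => ?_
  · simpa using hs w v
  · refine (h x).trans_eq ?_
    simp only [dotProduct, Matrix.mulVec, mul_sum, star_trivial]
    exact sum_congr rfl fun v _ => sum_congr rfl fun w _ => by ring

theorem sum_nonneg_of_posSemidef {V : Type*} [Fintype V] {M : Matrix V V ℝ}
    (hM : M.PosSemidef) (x : V → ℝ) : 0 ≤ ∑ v, ∑ w, M v w * (x v * x w) := by
  refine (hM.dotProduct_mulVec_nonneg x).trans_eq ?_
  simp only [dotProduct, Matrix.mulVec, mul_sum, star_trivial]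
  exact sum_congr rfl fun v _ => sum_congr rfl fun w _ => by ring

theorem exists_min_quadratic {V : Type*} [Fintype V] [Nonempty V] (M : V → V → ℝ) :
    ∃ x₀ : V → ℝ, ∑ v, x₀ v ^ 2 = 1 ∧ ∀ x : V → ℝ,
      (∑ v, ∑ w, M v w * (x₀ v * x₀ w)) * ∑ v, x v ^ 2 ≤ ∑ v, ∑ w, M v w * (x v * x w) := by
  classical
  have hcomp : IsCompact {x : V → ℝ | ∑ v, x v ^ 2 = 1} := by
    refine isCompact_Icc.of_isClosed_subset
      (s := Set.Icc (fun _ => (-1 : ℝ)) fun _ => 1)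
      (isClosed_eq (by fun_prop) continuous_const) fun x hx => ?_
    have hv : ∀ v, |x v| ≤ 1 := fun v => by
      rw [← sq_le_one_iff_abs_le_one]
      exact (single_le_sum (f := fun v => x v ^ 2) (fun v _ => sq_nonneg _) (mem_univ v)).trans_eq hx
    exact ⟨fun v => (abs_le.1 (hv v)).1, fun v => (abs_le.1 (hv v)).2⟩
  obtain ⟨v₀⟩ := ‹Nonempty V›
  obtain ⟨x₀, hx₀, hmin⟩ := hcomp.exists_isMinOn
    (f := fun x : V → ℝ => ∑ v, ∑ w, M v w * (x v * x w))
    ⟨Pi.single v₀ 1, by simp [Pi.single_apply]⟩ (by fun_prop)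
  refine ⟨x₀, hx₀, fun x => ?_⟩
  have h0 : 0 ≤ ∑ v, x v ^ 2 := sum_nonneg fun v _ => sq_nonneg _
  rcases h0.eq_or_lt with h | h
  · have hx : ∀ v, x v = 0 := fun v => by
      simpa using (sum_eq_zero_iff_of_nonneg fun v _ => sq_nonneg (x v)).1 h.symm v (mem_univ v)
    simp [hx]
  · set c := √(∑ v, x v ^ 2) with hc
    have hc0 : 0 < c := Real.sqrt_pos.2 h
    have hc2 : c ^ 2 = ∑ v, x v ^ 2 := Real.sq_sqrt h0
    have h1 : (fun v => x v / c) ∈ {x : V → ℝ | ∑ v, x v ^ 2 = 1} := by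
      change ∑ v, (x v / c) ^ 2 = 1
      simp only [div_pow, ← sum_div]
      rw [hc2, div_self h.ne']
    have h2 := isMinOn_iff.1 hmin _ h1
    have h3 : ∑ v, ∑ w, M v w * (x v / c * (x w / c))
        = (∑ v, ∑ w, M v w * (x v * x w)) / c ^ 2 := by
      rw [sum_div]
      refine sum_congr rfl fun v _ => ?_
      rw [sum_div]
      exact sum_congr rfl fun w _ => by field_simp
    simp only [h3] at h2
    rw [← hc2]
    exact (le_div_iff₀ (by positivity)).1 h2

section Theta

variable {V : Type*} (G : SimpleGraph V)

open Classical in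
/-- The real adjacency matrix of `G`. -/
noncomputable def adj : Matrix V V ℝ := fun v w => if G.Adj v w then 1 else 0

variable {G}

theorem adj_comm (v w : V) : adj G v w = adj G w v := by
  classical exact if_congr (G.adj_comm v w) rfl rfl

theorem adj_map (φ : G ≃g G) (v w : V) : adj G (φ v) (φ w) = adj G v w := by
  classical exact if_congr φ.map_adj_iff rfl rfl

theorem adj_nonneg (v w : V) : 0 ≤ adj G v w := by
  unfold adj
  split_ifs <;> simp

variable [Fintype V]

theorem sum_adj_eq_of_vertexTransitive (hv : VertexTransitive G) (u v : V) :
    ∑ w, adj G v w = ∑ w, adj G u w := by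
  obtain ⟨φ, rfl⟩ := hv u v
  rw [← φ.toEquiv.sum_comp]
  exact sum_congr rfl fun w _ => adj_map φ u w

theorem abs_adj_form_le {k : ℝ} (hk : ∀ v, ∑ w, adj G v w = k) (x : V → ℝ) :
    |∑ v, ∑ w, adj G v w * (x v * x w)| ≤ k * ∑ v, x v ^ 2 := by
  have h1 : ∑ v, ∑ w, adj G v w * x v ^ 2 = k * ∑ v, x v ^ 2 := by
    simp only [← sum_mul, hk, ← mul_sum]
  have h2 : ∑ v, ∑ w, adj G v w * x w ^ 2 = k * ∑ v, x v ^ 2 := by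
    rw [sum_comm, ← h1]
    exact sum_congr rfl fun v _ => sum_congr rfl fun w _ => by rw [adj_comm]
  have h3 : ∀ e : ℝ, e ^ 2 = 1 → 0 ≤ 2 * (k * ∑ v, x v ^ 2)
      + 2 * e * ∑ v, ∑ w, adj G v w * (x v * x w) := by
    intro e he
    have : 2 * (k * ∑ v, x v ^ 2) + 2 * e * ∑ v, ∑ w, adj G v w * (x v * x w)
        = ∑ v, ∑ w, adj G v w * (x v + e * x w) ^ 2 := by
      rw [two_mul (k * _)]
      nth_rw 1 [← h1]
      rw [← h2]
      simp only [mul_sum, ← sum_add_distrib]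
      exact sum_congr rfl fun v _ => sum_congr rfl fun w _ => by
        linear_combination (-adj G v w * x w ^ 2) * he
    rw [this]
    exact sum_nonneg fun v _ => sum_nonneg fun w _ => mul_nonneg (adj_nonneg _ _) (sq_nonneg _)
  rw [abs_le]
  constructor <;> linarith [h3 1 (by norm_num), h3 (-1) (by norm_num)]

/-- Averaging the rank-one form `x₀ x₀ᵀ` over the automorphism group: a positive semidefinite `T`
supported on the diagonal and the edges satisfies the inequality of its averaged version, which
has the shape `a I + b A`. -/
theorem mul_sum_adj_le_mul_sum_diag (hv : VertexTransitive G) (he : EdgeTransitive G)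
    {u₀ w₀ : V} (huw : G.Adj u₀ w₀) {k : ℝ} (hk : ∀ v, ∑ w, adj G v w = k) (hk0 : 0 < k)
    {x₀ : V → ℝ} (hx₀ : ∑ v, x₀ v ^ 2 = 1) {τ : ℝ}
    (hτ : ∑ v, ∑ w, adj G v w * (x₀ v * x₀ w) = -τ) {T : Matrix V V ℝ} (hT : T.PosSemidef)
    (hT0 : ∀ v w, v ≠ w → ¬ G.Adj v w → T v w = 0) :
    τ * ∑ v, ∑ w, adj G v w * T v w ≤ k * ∑ v, T v v := by
  classical
  have : Finite (G ≃g G) := DFunLike.finite _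
  let : Fintype (G ≃g G) := Fintype.ofFinite _
  set P : V → V → ℝ := fun v w => ∑ φ : G ≃g G, x₀ (φ v) * x₀ (φ w) with hP
  have hPinv : ∀ (ψ : G ≃g G) v w, P (ψ v) (ψ w) = P v w := fun ψ v w =>
    Fintype.sum_equiv (Equiv.mulRight ψ) _ _ fun _ => rfl
  have hPcomm : ∀ v w, P v w = P w v := fun v w => sum_congr rfl fun φ _ => mul_comm _ _
  set N : ℝ := (Fintype.card V : ℝ) with hN
  have hN0 : 0 < N := by
    have : Nonempty V := ⟨u₀⟩
    exact Nat.cast_pos.2 Fintype.card_pos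
  set c : ℝ := (Fintype.card (G ≃g G) : ℝ) with hc
  have hc0 : 0 < c := by
    have : Nonempty (G ≃g G) := ⟨1⟩
    exact Nat.cast_pos.2 Fintype.card_pos
  have hdiag : ∀ v, P v v = P u₀ u₀ := fun v => by
    obtain ⟨φ, rfl⟩ := hv u₀ v
    exact hPinv φ _ _
  have hedge : ∀ v w, adj G v w * P v w = adj G v w * P u₀ w₀ := fun v w => by
    by_cases h : G.Adj v w
    · obtain ⟨φ, hφ⟩ := he s(u₀, w₀) huw s(v, w) h
      rw [Sym2.map_mk, Sym2.eq_iff] at hφ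
      rcases hφ with ⟨rfl, rfl⟩ | ⟨rfl, rfl⟩
      · rw [hPinv]
      · rw [hPcomm, hPinv]
    · simp [adj, h]
  have e0 : N * P u₀ u₀ = c := by
    have h1 : ∑ v, P v v = N * P u₀ u₀ := by
      rw [sum_congr rfl fun v _ => hdiag v]
      simp [hN]
    rw [← h1, hP, sum_comm]
    have h2 : ∀ φ : G ≃g G, ∑ v, x₀ (φ v) * x₀ (φ v) = 1 := fun φ => by
      rw [← hx₀, ← φ.toEquiv.sum_comp fun v => x₀ v ^ 2]
      exact sum_congr rfl fun v _ => (sq _).symm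
    simp [h2, hc]
  have e1 : N * k * P u₀ w₀ = -τ * c := by
    have h1 : ∑ v, ∑ w, adj G v w * P v w = N * k * P u₀ w₀ := by
      simp only [hedge, ← sum_mul, hk]
      simp [hN]
    rw [← h1]
    have h2 : ∀ φ : G ≃g G, ∑ v, ∑ w, adj G v w * (x₀ (φ v) * x₀ (φ w)) = -τ := fun φ => by
      rw [← hτ, ← φ.toEquiv.sum_comp fun v => ∑ w, adj G v w * (x₀ v * x₀ w)]
      refine sum_congr rfl fun v _ => ?_
      rw [← φ.toEquiv.sum_comp fun w => adj G (φ.toEquiv v) w * (x₀ (φ.toEquiv v) * x₀ w)]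
      exact sum_congr rfl fun w _ => by rw [← adj_map φ v w]; rfl
    simp only [hP, mul_sum]
    rw [sum_congr rfl fun v _ => sum_comm, sum_comm, sum_congr rfl fun φ _ => h2 φ]
    simp [hc, mul_comm]
  have hTP : 0 ≤ ∑ v, ∑ w, T v w * P v w := by
    have : ∑ v, ∑ w, T v w * P v w
        = ∑ φ : G ≃g G, ∑ v, ∑ w, T v w * (x₀ (φ v) * x₀ (φ w)) := by
      simp only [hP, mul_sum]
      rw [sum_congr rfl fun v _ => sum_comm, sum_comm]
    rw [this]
    exact sum_nonneg fun φ _ => sum_nonneg_of_posSemidef hT fun v => x₀ (φ v)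
  have hsplit : ∑ v, ∑ w, T v w * P v w
      = P u₀ u₀ * ∑ v, T v v + P u₀ w₀ * ∑ v, ∑ w, adj G v w * T v w := by
    have h1 : ∀ v w, T v w * P v w
        = (if v = w then T v v * P u₀ u₀ else 0) + adj G v w * T v w * P u₀ w₀ := fun v w => by
      by_cases h : v = w
      · subst h
        simp [hdiag v, adj]
      · by_cases ha : G.Adj v w
        · have := hedge v w
          simp only [adj, ha, if_true, one_mul] at this
          simp [h, adj, ha, this]
        · simp [h, adj, ha, hT0 v w h ha]
    simp only [h1, sum_add_distrib, sum_ite_eq, mem_univ, if_true, ← sum_mul]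
    ring
  rw [hsplit] at hTP
  have h3 : 0 ≤ c * (k * ∑ v, T v v - τ * ∑ v, ∑ w, adj G v w * T v w) := by
    have h4 := mul_nonneg (mul_nonneg hN0.le hk0.le) hTP
    refine h4.trans_eq ?_
    linear_combination (k * ∑ v, T v v) * e0 + (∑ v, ∑ w, adj G v w * T v w) * e1
  linarith [nonneg_of_mul_nonneg_right h3 hc0]

theorem sum_eq_diag_add_adj {T : Matrix V V ℝ}
    (hT0 : ∀ v w, v ≠ w → ¬ G.Adj v w → T v w = 0) :
    ∑ v, ∑ w, T v w = ∑ v, T v v + ∑ v, ∑ w, adj G v w * T v w := by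
  classical
  have h1 : ∀ v w, T v w = (if v = w then T v v else 0) + adj G v w * T v w := fun v w => by
    by_cases h : v = w
    · subst h
      simp [adj]
    · by_cases ha : G.Adj v w
      · simp [h, adj, ha]
      · simp [h, adj, ha, hT0 v w h ha]
  rw [← sum_add_distrib]
  refine sum_congr rfl fun v _ => ?_
  rw [sum_congr rfl fun w _ => h1 v w, sum_add_distrib]
  simp

/-- For a `k`-regular graph whose adjacency matrix has least eigenvalue `-τ`, the form of `A + τ I`
dominates that of the multiple of the all-ones matrix with the same value at the constants. -/
theorem sq_sum_le_adj_form [Nonempty V] {k τ : ℝ} (hk : ∀ v, ∑ w, adj G v w = k)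
    (hτ : ∀ x : V → ℝ, -τ * ∑ v, x v ^ 2 ≤ ∑ v, ∑ w, adj G v w * (x v * x w)) (x : V → ℝ) :
    (k + τ) / Fintype.card V * (∑ v, x v) ^ 2
      ≤ ∑ v, ∑ w, adj G v w * (x v * x w) + τ * ∑ v, x v ^ 2 := by
  set N : ℝ := (Fintype.card V : ℝ) with hN
  have hN0 : 0 < N := by exact Nat.cast_pos.2 Fintype.card_pos
  set c : ℝ := (∑ v, x v) / N with hc
  have hcN : ∑ v, x v = c * N := by rw [hc]; field_simp
  have h := hτ fun v => x v - c
  have e1 : ∑ v, (x v - c) ^ 2 = ∑ v, x v ^ 2 - 2 * c * ∑ v, x v + N * c ^ 2 := by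
    simp only [sub_sq, sum_add_distrib, sum_sub_distrib, ← sum_mul, ← mul_sum]
    simp [hN]
    ring
  have r1 : ∑ v, ∑ w, adj G v w * x v = k * ∑ v, x v := by
    simp only [← sum_mul, hk, ← mul_sum]
  have r2 : ∑ v, ∑ w, adj G v w * x w = k * ∑ v, x v := by
    rw [sum_comm, ← r1]
    exact sum_congr rfl fun v _ => sum_congr rfl fun w _ => by rw [adj_comm]
  have r3 : ∑ v : V, ∑ w, adj G v w = N * k := by simp [hk, hN]
  have e2 : ∑ v, ∑ w, adj G v w * ((x v - c) * (x w - c))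
      = ∑ v, ∑ w, adj G v w * (x v * x w) - c * (k * ∑ v, x v) - c * (k * ∑ v, x v)
        + c ^ 2 * (N * k) := by
    nth_rw 1 [← r1]
    rw [← r2, ← r3]
    simp only [mul_sum, ← sum_add_distrib, ← sum_sub_distrib]
    exact sum_congr rfl fun v _ => sum_congr rfl fun w _ => by ring
  rw [e1, e2, hcN] at h
  rw [hcN]
  have e3 : (k + τ) / N * (c * N) ^ 2 = (k + τ) * c ^ 2 * N := by field_simp
  rw [e3]
  nlinarith

/-- The extremal matrix: a rescaling `W` of an optimal matrix for the theta function, which is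
`I + A / τ` with `-τ` the least eigenvalue of the adjacency matrix `A`. With `q = |V| / θ` its
eigenvalues lie in `[0, q]`, as for the all-ones matrix of order `q`. -/
theorem exists_extremal_matrix [DecidableEq V] (hv : VertexTransitive G) (he : EdgeTransitive G)
    (hne : ∃ u v : V, G.Adj u v) :
    0 < lovaszTheta G ∧ 2 ≤ (Fintype.card V : ℝ) / lovaszTheta G ∧ ∃ W : Matrix V V ℝ,
      (∀ v, W v v = 1) ∧ (∀ v w, 0 ≤ W v w) ∧ (∀ v w, v ≠ w → ¬ G.Adj v w → W v w = 0) ∧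
      (W - Matrix.of fun _ _ => (lovaszTheta G)⁻¹).PosSemidef ∧
      (((Fintype.card V : ℝ) / lovaszTheta G) • (1 : Matrix V V ℝ) - W).PosSemidef := by
  obtain ⟨u₀, w₀, huw⟩ := hne
  have : Nonempty V := ⟨u₀⟩
  obtain ⟨k, hk⟩ : ∃ k, ∀ v, ∑ w, adj G v w = k :=
    ⟨_, sum_adj_eq_of_vertexTransitive hv u₀⟩
  obtain ⟨x₀, hx₀, hmin⟩ := exists_min_quadratic (adj G)
  obtain ⟨τ, hτ⟩ : ∃ τ, ∑ v, ∑ w, adj G v w * (x₀ v * x₀ w) = -τ := ⟨_, (neg_neg _).symm⟩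
  rw [hτ] at hmin
  have hτk : τ ≤ k := by
    have := (abs_le.1 (abs_adj_form_le hk x₀)).1
    rw [hτ, hx₀] at this
    linarith
  have hτ1 : 0 < τ := by
    have h := hmin (Pi.single u₀ 1 - Pi.single w₀ 1)
    have hu : u₀ ≠ w₀ := huw.ne
    have e1 : ∑ v, (Pi.single u₀ 1 - Pi.single w₀ 1 : V → ℝ) v ^ 2 = 2 := by
      simp [sub_sq, sum_add_distrib, sum_sub_distrib, Pi.single_apply, hu.symm]
      norm_num
    have e2 : ∑ v, ∑ w, adj G v w * ((Pi.single u₀ 1 - Pi.single w₀ 1 : V → ℝ) v *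
        (Pi.single u₀ 1 - Pi.single w₀ 1 : V → ℝ) w) = -2 := by
      simp [mul_sub, sum_sub_distrib, Pi.single_apply, adj, huw, huw.symm]
      norm_num
    rw [e1, e2] at h
    linarith
  have hk0 : 0 < k := hτ1.trans_le hτk
  set N : ℝ := (Fintype.card V : ℝ) with hN
  have hN0 : 0 < N := by exact Nat.cast_pos.2 Fintype.card_pos
  set W : Matrix V V ℝ := 1 + τ⁻¹ • adj G with hW
  have hWdiag : ∀ v, W v v = 1 := fun v => by simp [hW, adj]
  have hW0 : ∀ v w, v ≠ w → ¬ G.Adj v w → W v w = 0 := fun v w h ha => by simp [hW, adj, h, ha]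
  have hWs : ∀ v w, W v w = W w v := fun v w => by
    simp [hW, adj_comm v w, Matrix.one_apply, eq_comm]
  have hWform : ∀ x : V → ℝ, ∑ v, ∑ w, W v w * (x v * x w)
      = ∑ v, x v ^ 2 + τ⁻¹ * ∑ v, ∑ w, adj G v w * (x v * x w) := fun x => by
    simp only [hW, Matrix.add_apply, Matrix.smul_apply, smul_eq_mul, add_mul, sum_add_distrib,
      Matrix.one_apply, ite_mul, one_mul, zero_mul, sum_ite_eq, mem_univ, if_true, mul_sum, sq,
      mul_assoc]
  set θ : ℝ := N * τ / (k + τ) with hθ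
  have hkτ : 0 < k + τ := by linarith
  have hθ0 : 0 < θ := by positivity
  have hqeq : N / θ = (k + τ) / τ := by rw [hθ]; field_simp
  have hpsd : (W - Matrix.of fun _ _ => θ⁻¹).PosSemidef := by
    refine posSemidef_of_sum_nonneg (fun v w => by simp [hWs v w]) fun x => ?_
    have e : ∑ v, ∑ w, (W - Matrix.of (fun _ _ => θ⁻¹) : Matrix V V ℝ) v w * (x v * x w)
        = ∑ v, ∑ w, W v w * (x v * x w) - θ⁻¹ * (∑ v, x v) ^ 2 := by
      rw [sq, sum_mul_sum]
      simp only [Matrix.sub_apply, Matrix.of_apply, sub_mul, sum_sub_distrib, mul_sum]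
    rw [e, hWform]
    have h := mul_le_mul_of_nonneg_left (sq_sum_le_adj_form hk hmin x) (inv_nonneg.2 hτ1.le)
    have e2 : τ⁻¹ * ((k + τ) / N * (∑ v, x v) ^ 2) = θ⁻¹ * (∑ v, x v) ^ 2 := by
      rw [hθ]; field_simp
    rw [← hN, e2, mul_add, inv_mul_cancel_left₀ hτ1.ne'] at h
    linarith
  have htheta : lovaszTheta G = θ := by
    refine IsLeast.csInf_eq ⟨⟨θ • W, ?_, fun v w h ha => ?_, ?_⟩, ?_⟩
    · have : θ • W - Matrix.of (fun _ _ => (1 : ℝ)) = θ • (W - Matrix.of fun _ _ => θ⁻¹) := by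
        ext v w
        simp [mul_sub, hθ0.ne']
      rw [this]
      exact hpsd.smul hθ0.le
    · simp [hW0 v w h ha]
    · simp [hWdiag]
    · rintro t ⟨T, hT, hT0, rfl⟩
      have hJ : (Matrix.of fun _ _ => (1 : ℝ) : Matrix V V ℝ).PosSemidef := by
        convert Matrix.posSemidef_vecMulVec_self_star (fun _ : V => (1 : ℝ)) using 1
        ext; simp [Matrix.vecMulVec_apply]
      have hT' : T.PosSemidef := by simpa using hT.add hJ
      have h1 := mul_sum_adj_le_mul_sum_diag hv he huw hk hk0 hx₀ hτ hT' hT0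
      have h2 : N ^ 2 ≤ ∑ v, T v v + ∑ v, ∑ w, adj G v w * T v w := by
        rw [← sum_eq_diag_add_adj hT0]
        have := sum_nonneg_of_posSemidef hT fun _ => 1
        simp only [Matrix.sub_apply, Matrix.of_apply, mul_one, sum_sub_distrib, sum_const,
          card_univ, nsmul_eq_mul, ← hN] at this
        linarith
      have h3 : ∑ v, T v v ≤ N * ⨆ v, T v v := by
        have : ∀ v ∈ univ, T v v ≤ ⨆ v, T v v := fun v _ =>
          le_ciSup (f := fun v => T v v) (Set.finite_range _).bddAbove v
        simpa [hN] using sum_le_card_nsmul univ _ _ this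
      have h4 : τ * N ^ 2 ≤ (k + τ) * (N * ⨆ v, T v v) := by
        have := mul_le_mul_of_nonneg_left h2 hτ1.le
        have := mul_le_mul_of_nonneg_left h3 hkτ.le
        linarith
      rw [hθ, div_le_iff₀ hkτ]
      refine le_of_mul_le_mul_left ?_ hN0
      linarith
  rw [htheta]
  refine ⟨hθ0, ?_, W, hWdiag, fun v w => ?_, hW0, hpsd, ?_⟩
  · rw [hqeq, le_div_iff₀ hτ1]
    linarith
  · have := adj_nonneg (G := G) v w
    simp only [hW, Matrix.add_apply, Matrix.smul_apply, smul_eq_mul, Matrix.one_apply]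
    split_ifs <;> positivity
  · rw [hqeq]
    refine posSemidef_of_sum_nonneg (fun v w => ?_) fun x => ?_
    · simp [hWs v w, Matrix.one_apply, eq_comm]
    · have e : ∑ v, ∑ w, (((k + τ) / τ) • (1 : Matrix V V ℝ) - W) v w * (x v * x w)
          = (k + τ) / τ * ∑ v, x v ^ 2 - ∑ v, ∑ w, W v w * (x v * x w) := by
        simp [sub_mul, sum_sub_distrib, Matrix.one_apply, mul_sum, sq]
      have h := mul_le_mul_of_nonneg_left (abs_le.1 (abs_adj_form_le hk x)).2
        (inv_nonneg.2 hτ1.le)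
      have e2 : (k + τ) / τ * ∑ v, x v ^ 2 = ∑ v, x v ^ 2 + τ⁻¹ * (k * ∑ v, x v ^ 2) := by
        field_simp
        ring
      rw [e, hWform, e2]
      linarith

end Theta

open Filter Topology

/-! ### Asymptotics -/

/-- The relative radius at which the radial adjacency operator, restricted to a ball, has spectral
radius `(q - 1 - q δ) n` asymptotically. -/
noncomputable def lpRadius (q δ : ℝ) : ℝ :=
  ((q - 1) - (q - 2) * δ - 2 * √((q - 1) * δ * (1 - δ))) / q

theorem lpRadius_spec {q δ : ℝ} (hq : 2 ≤ q) (hδ : 0 < δ) (hδ1 : δ < 1 - 1 / q) :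
    0 < lpRadius q δ ∧ q * lpRadius q δ ≤ q - 1 ∧
      2 * √(lpRadius q δ * ((1 - lpRadius q δ) * (q - 1))) + lpRadius q δ * (q - 2)
        = (q - 1) - q * δ := by
  have hq0 : 0 < q := by linarith
  have hqδ : q * δ < q - 1 := by
    have := mul_lt_mul_of_pos_left hδ1 hq0
    rwa [mul_sub, mul_one, mul_one_div_cancel hq0.ne'] at this
  have hδ2 : δ < 1 := by nlinarith
  have ha2 : √((q - 1) * (1 - δ)) ^ 2 = (q - 1) * (1 - δ) :=
    Real.sq_sqrt (mul_nonneg (by linarith) (by linarith))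
  have hb2 : √δ ^ 2 = δ := Real.sq_sqrt hδ.le
  have hba : √δ < √((q - 1) * (1 - δ)) := Real.sqrt_lt_sqrt hδ.le (by nlinarith)
  have hb : 0 ≤ √δ := Real.sqrt_nonneg _
  have hab : √((q - 1) * δ * (1 - δ)) = √((q - 1) * (1 - δ)) * √δ := by
    rw [← Real.sqrt_mul (mul_nonneg (by linarith) (by linarith))]
    congr 1
    ring
  set a := √((q - 1) * (1 - δ))
  set b := √δ
  have hρ : q * lpRadius q δ = (a - b) ^ 2 := by
    rw [lpRadius, hab, mul_div_cancel₀ _ hq0.ne']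
    linear_combination (-1 : ℝ) * ha2 - hb2
  have hρ' : lpRadius q δ = (a - b) ^ 2 / q := by rw [← hρ]; field_simp
  have h0 : 0 < a - b := sub_pos.2 hba
  refine ⟨by rw [hρ']; positivity, ?_, ?_⟩
  · rw [hρ]
    nlinarith
  · have e : lpRadius q δ * ((1 - lpRadius q δ) * (q - 1))
        = ((a - b) * (a + (q - 1) * b) / q) ^ 2 := by
      have h1 : q * (1 - lpRadius q δ) * (q - 1) = (a + (q - 1) * b) ^ 2 := by
        have : q * (1 - lpRadius q δ) = q - (a - b) ^ 2 := by rw [mul_sub, hρ, mul_one]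
        rw [this]
        linear_combination (-q) * ha2 - q * (q - 1) * hb2
      rw [div_pow, mul_pow, ← hρ, ← h1]
      field_simp
    have h2 : 0 ≤ (a - b) * (a + (q - 1) * b) / q :=
      div_nonneg (mul_nonneg h0.le (by nlinarith)) hq0.le
    rw [e, Real.sqrt_sq h2, hρ']
    field_simp
    linear_combination q * ha2 - q * hb2

theorem lpRadius_one_sub_inv {q : ℝ} (hq : 2 ≤ q) : lpRadius q (1 - 1 / q) = 0 := by
  have hq0 : 0 < q := by linarith
  have e : (q - 1) * (1 - 1 / q) * (1 - (1 - 1 / q)) = ((q - 1) / q) ^ 2 := by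
    field_simp
    ring
  rw [lpRadius, e, Real.sqrt_sq (div_nonneg (by linarith) hq0.le)]
  field_simp
  ring

theorem lpRadius_zero (q : ℝ) : lpRadius q 0 = (q - 1) / q := by simp [lpRadius]

theorem continuous_lpRadius (q : ℝ) : Continuous (lpRadius q) := by
  unfold lpRadius
  fun_prop

theorem continuous_entropyQ (q : ℝ) : Continuous (entropyQ q) := by
  have h1 := Real.continuous_mul_log
  have h2 : Continuous fun x : ℝ => (1 - x) * Real.log (1 - x) :=
    h1.comp (continuous_const.sub continuous_id)
  exact ((continuous_id.mul continuous_const).sub h1).sub h2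

/-- A window of constant length `m`, ending at relative radius `ρ`, on which the test vector of
`exists_radialAdj_ge` beats the target eigenvalue, provided that the limiting spectral radius at `ρ`
strictly does. -/
theorem eventually_window {q ρ δ : ℝ} (hρ0 : 0 < ρ) (hρ1 : ρ < 1)
    (h : (q - 1) - q * δ < 2 * √(ρ * ((1 - ρ) * (q - 1))) + ρ * (q - 2)) :
    ∃ m : ℕ, 0 < m ∧ ∀ᶠ n : ℕ in atTop, ∃ l : ℕ, 0 < l ∧ l + m < n ∧ ((l + m : ℕ) : ℝ) ≤ ρ * n ∧
      n * (q - 1) - q * (δ * n) + 1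
        ≤ 2 * Real.cos (Real.pi / (m + 1)) * √(l * ((n - l - m) * (q - 1))) + l * (q - 2) := by
  have hm : Tendsto (fun m : ℕ => 2 * Real.cos (Real.pi / (m + 1)) * √(ρ * ((1 - ρ) * (q - 1)))
      + ρ * (q - 2)) atTop (𝓝 (2 * Real.cos 0 * √(ρ * ((1 - ρ) * (q - 1))) + ρ * (q - 2))) := by
    have h1 : Tendsto (fun m : ℕ => Real.pi / ((m : ℝ) + 1)) atTop (𝓝 0) :=
      tendsto_const_nhds.div_atTop
        (tendsto_atTop_add_const_right _ _ tendsto_natCast_atTop_atTop)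
    exact ((((Real.continuous_cos.tendsto 0).comp h1).const_mul 2).mul_const _).add_const _
  rw [Real.cos_zero, mul_one] at hm
  obtain ⟨m, hm1, hm0⟩ := ((hm.eventually (lt_mem_nhds h)).and (eventually_gt_atTop 0)).exists
  refine ⟨m, hm0, ?_⟩
  set γ := Real.cos (Real.pi / (m + 1))
  have hinv : Tendsto (fun n : ℕ => (1 : ℝ) / n) atTop (𝓝 0) := tendsto_one_div_atTop_nhds_zero_nat
  have hmn : Tendsto (fun n : ℕ => (m : ℝ) / n) atTop (𝓝 0) :=
    tendsto_const_nhds.div_atTop tendsto_natCast_atTop_atTop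
  have hfl : Tendsto (fun n : ℕ => (⌊ρ * n⌋₊ : ℝ) / n) atTop (𝓝 ρ) :=
    (tendsto_nat_floor_mul_div_atTop hρ0.le).comp tendsto_natCast_atTop_atTop
  have hl : Tendsto (fun n : ℕ => (⌊ρ * n⌋₊ : ℝ) / n - m / n) atTop (𝓝 ρ) := by
    simpa using hfl.sub hmn
  have hF : Tendsto (fun n : ℕ => 2 * γ * √(((⌊ρ * n⌋₊ : ℝ) / n - m / n) *
      ((1 - ((⌊ρ * n⌋₊ : ℝ) / n - m / n) - m / n) * (q - 1)))
      + ((⌊ρ * n⌋₊ : ℝ) / n - m / n) * (q - 2) - 1 / n) atTop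
      (𝓝 (2 * γ * √(ρ * ((1 - ρ - 0) * (q - 1))) + ρ * (q - 2) - 0)) := by
    refine ((Tendsto.const_mul _ ?_).add (hl.mul_const _)).sub hinv
    exact (Real.continuous_sqrt.tendsto _).comp
      (hl.mul (((tendsto_const_nhds.sub hl).sub hmn).mul_const _))
  rw [sub_zero, sub_zero] at hF
  have hfloor : Tendsto (fun n : ℕ => ⌊ρ * n⌋₊) atTop atTop :=
    tendsto_nat_floor_atTop.comp (tendsto_natCast_atTop_atTop.const_mul_atTop hρ0)
  filter_upwards [hF.eventually (lt_mem_nhds hm1), hfloor.eventually (eventually_gt_atTop m),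
    eventually_gt_atTop 0] with n h1 h2 h3
  have hn : (0 : ℝ) < n := by exact_mod_cast h3
  have hle : (⌊ρ * n⌋₊ : ℝ) ≤ ρ * n := Nat.floor_le (by positivity)
  have hr : ⌊ρ * n⌋₊ - m + m = ⌊ρ * n⌋₊ := Nat.sub_add_cancel h2.le
  have hlt : ⌊ρ * n⌋₊ < n := by
    have : (⌊ρ * n⌋₊ : ℝ) < n := hle.trans_lt (by nlinarith)
    exact_mod_cast this
  refine ⟨⌊ρ * n⌋₊ - m, by omega, by omega, by rw [hr]; exact hle, ?_⟩
  rw [Nat.cast_sub h2.le]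
  set L : ℝ := (⌊ρ * n⌋₊ : ℝ) - m with hL
  have e1 : (⌊ρ * n⌋₊ : ℝ) / n - m / n = L / n := by rw [hL, sub_div]
  have e2 : L / n * ((1 - L / n - m / n) * (q - 1))
      = L * ((n - L - m) * (q - 1)) / (n : ℝ) ^ 2 := by field_simp
  rw [e1, e2, Real.sqrt_div' _ (by positivity), Real.sqrt_sq hn.le] at h1
  have h4 := mul_lt_mul_of_pos_left h1 hn
  have e3 : (n : ℝ) * (2 * γ * (√(L * ((n - L - m) * (q - 1))) / n) + L / n * (q - 2) - 1 / n)
      = 2 * γ * √(L * ((n - L - m) * (q - 1))) + L * (q - 2) - 1 := by field_simp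
  rw [e3] at h4
  linarith

section Rate

variable {V : Type*} {G : SimpleGraph V}

theorem wordDist_eq_hammingDist [DecidableEq V] {n : ℕ} {x y : Fin n → V}
    (h : ∀ i, x i ≠ y i → G.Adj (x i) (y i)) : wordDist G x y = (hammingDist x y : ℝ≥0∞) := by
  rw [wordDist, hammingDist, ← sum_boole]
  refine sum_congr rfl fun i _ => ?_
  by_cases hi : x i = y i
  · simp [vertexDist, hi]
  · simp [vertexDist, hi, h i hi]

variable [Fintype V]

theorem rate_le_of_eventually [Nonempty V] {δ θ c H : ℝ} (hθ : 0 < θ) (hc : 0 < c)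
    (h : ∀ᶠ n : ℕ in atTop, ((powerGraph G n (δ * n)).indepNum : ℝ)
      ≤ θ ^ n * (c * n * Real.exp (n * H))) :
    rate G δ ≤ Real.log θ + H := by
  classical
  refine le_of_forall_pos_le_add fun ε hε => ?_
  have hlim : Tendsto (fun n : ℕ => Real.log c / n + Real.log n / n) atTop (𝓝 (0 + 0)) :=
    (tendsto_const_nhds.div_atTop tendsto_natCast_atTop_atTop).add
      (Real.isLittleO_log_id_atTop.tendsto_div_nhds_zero.comp tendsto_natCast_atTop_atTop)
  rw [add_zero] at hlim
  refine limsup_le_of_le (isCoboundedUnder_le_of_le atTop (x := 0) fun n => ?_) ?_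
  · exact mul_nonneg (by positivity) (Real.log_natCast_nonneg _)
  · filter_upwards [h, hlim.eventually (gt_mem_nhds hε), eventually_gt_atTop 0] with n h1 h2 h3
    have hn : (0 : ℝ) < n := by exact_mod_cast h3
    have hpos : (0 : ℝ) < (powerGraph G n (δ * n)).indepNum := by
      obtain ⟨v⟩ := ‹Nonempty V›
      have := SimpleGraph.IsIndepSet.card_le_indepNum (G := powerGraph G n (δ * n))
        (t := {fun _ => v}) (by simp [SimpleGraph.IsIndepSet])
      rw [card_singleton] at this
      exact_mod_cast this
    have h4 := Real.log_le_log hpos h1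
    rw [Real.log_mul (by positivity) (by positivity), Real.log_mul (by positivity) (by positivity),
      Real.log_mul hc.ne' hn.ne', Real.log_exp, Real.log_pow] at h4
    have h5 := mul_le_mul_of_nonneg_left h4 (by positivity : 0 ≤ 1 / (n : ℝ))
    have e : 1 / (n : ℝ) * (n * Real.log θ + (Real.log c + Real.log n + n * H))
        = Real.log θ + H + (Real.log c / n + Real.log n / n) := by
      field_simp
      ring
    rw [e] at h5
    linarith

theorem rate_le_log_card [Nonempty V] (δ : ℝ) :
    rate G δ ≤ Real.log (Fintype.card V) := by
  classical
  have hN : (0 : ℝ) < Fintype.card V := Nat.cast_pos.2 Fintype.card_pos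
  have := rate_le_of_eventually (G := G) (δ := δ) (H := 0) hN one_pos ?_
  · simpa using this
  · filter_upwards [eventually_ge_atTop 1] with n hn
    obtain ⟨C, hC⟩ := (powerGraph G n (δ * n)).exists_isNIndepSet_indepNum
    rw [← hC.card_eq]
    have h1 : (#C : ℝ) ≤ (Fintype.card V : ℝ) ^ n := by
      have := card_le_univ C
      rw [Fintype.card_fun, Fintype.card_fin] at this
      exact_mod_cast this
    have h2 : (1 : ℝ) ≤ n := by exact_mod_cast hn
    refine h1.trans ?_
    rw [mul_zero, Real.exp_zero, mul_one, one_mul]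
    exact le_mul_of_one_le_right (by positivity) h2

theorem rate_le_log_theta_add_entropyQ (hv : VertexTransitive G) (he : EdgeTransitive G)
    (hne : ∃ u v : V, G.Adj u v) {δ δ' : ℝ} (hδ' : 0 < δ') (hlt : δ' < δ)
    (hδ1 : δ' < 1 - 1 / ((Fintype.card V : ℝ) / lovaszTheta G)) :
    rate G δ ≤ Real.log (lovaszTheta G) + entropyQ ((Fintype.card V : ℝ) / lovaszTheta G)
      (lpRadius ((Fintype.card V : ℝ) / lovaszTheta G) δ') := by
  classical
  have : Nonempty V := ⟨hne.choose⟩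
  obtain ⟨hθ, hq, W, hdiag, hnn, hW0, hW, hqW⟩ := exists_extremal_matrix hv he hne
  set q := (Fintype.card V : ℝ) / lovaszTheta G
  obtain ⟨hρ0, hρ, hspec⟩ := lpRadius_spec hq hδ' hδ1
  set ρ := lpRadius q δ'
  have hq0 : 0 < q := by linarith
  have hδ : 0 < δ := hδ'.trans hlt
  obtain ⟨m, hm, hev⟩ := eventually_window (q := q) (δ := δ) hρ0 (by nlinarith)
    (by rw [hspec]; nlinarith)
  refine rate_le_of_eventually hθ (c := q * δ) (by positivity) ?_
  filter_upwards [hev] with n ⟨l, hl, hln, hlρ, hle⟩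
  obtain ⟨C, hC⟩ := (powerGraph G n (δ * n)).exists_isNIndepSet_indepNum
  rw [← hC.card_eq]
  obtain ⟨g, hg, hgr, hpos, hadj⟩ := exists_radialAdj_ge hq hl hm hln hle
  refine (card_le_of_radialAdj_ge hq hθ hdiag hnn hW hqW C (d := δ * n) (by positivity) ?_ hg hgr
    hpos hadj).trans ?_
  · intro x hx y hy hxy
    by_cases h : ∀ i, x i ≠ y i → G.Adj (x i) (y i)
    · left
      by_contra! hlt'
      refine hC.isIndepSet hx hy hxy ⟨hxy, ?_⟩
      rw [wordDist_eq_hammingDist h, ← ENNReal.ofReal_natCast]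
      exact ENNReal.ofReal_le_ofReal hlt'.le
    · push Not at h
      obtain ⟨i, hi, ha⟩ := h
      exact Or.inr ⟨i, hW0 _ _ hi ha⟩
  · have hb := ballVolume_le_exp_entropyQ (by linarith) hρ0 hρ hlρ
    rw [← mul_assoc q δ]
    gcongr

end Rate

end GraphRate

theorem mainTheorem1 {V : Type*} [Fintype V] (G : SimpleGraph V)
    (hvertex : GraphRate.VertexTransitive G) (hedge : GraphRate.EdgeTransitive G)
    (hne : ∃ u v : V, G.Adj u v) (δ : ℝ) (hδ : 0 ≤ δ) :
    GraphRate.rate G δ ≤ Real.log (GraphRate.lovaszTheta G) +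
      GraphRate.rateLP1 ((Fintype.card V : ℝ) / GraphRate.lovaszTheta G) δ := by
  classical
  open GraphRate in
  have : Nonempty V := ⟨hne.choose⟩
  obtain ⟨hθ, hq, -⟩ := exists_extremal_matrix hvertex hedge hne
  have hN : (0 : ℝ) < Fintype.card V := Nat.cast_pos.2 Fintype.card_pos
  have key := fun δ' h1 h2 h3 => rate_le_log_theta_add_entropyQ (δ := δ) (δ' := δ')
    hvertex hedge hne h1 h2 h3
  have hlogN : Real.log (Fintype.card V) = Real.log (lovaszTheta G)
      + Real.log ((Fintype.card V : ℝ) / lovaszTheta G) := by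
    rw [← Real.log_mul hθ.ne' (by positivity), mul_div_cancel₀ _ hθ.ne']
  set q := (Fintype.card V : ℝ) / lovaszTheta G
  have hq0 : 0 < q := by linarith
  have hq1 : 0 < 1 - 1 / q := by
    rw [sub_pos, div_lt_one hq0]
    linarith
  rcases hδ.eq_or_lt with rfl | hδ0
  · -- At `δ = 0` the right-hand side is `log |V|`.
    have e : rateLP1 q 0 = Real.log q := by
      rw [rateLP1, if_pos hq1]
      change entropyQ q (lpRadius q 0) = _
      have e1 : 1 - (q - 1) / q = q⁻¹ := by field_simp; ring
      rw [lpRadius_zero, entropyQ, e1, Real.log_div (by linarith) hq0.ne', Real.log_inv]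
      field_simp
      ring
    rw [e, ← hlogN]
    exact rate_le_log_card 0
  · have e : rateLP1 q δ = entropyQ q (lpRadius q (min δ (1 - 1 / q))) := by
      rw [rateLP1]
      split_ifs with h
      · rw [min_eq_left h.le]
        rfl
      · rw [min_eq_right (not_lt.1 h), lpRadius_one_sub_inv hq]
        simp [entropyQ]
    rw [e]
    set δ₀ := min δ (1 - 1 / q)
    have hδ₀ : 0 < δ₀ := lt_min hδ0 hq1
    have hcont : Filter.Tendsto (fun δ' => Real.log (lovaszTheta G) + entropyQ q (lpRadius q δ'))
        (nhdsWithin δ₀ (Set.Iio δ₀))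
        (nhds (Real.log (lovaszTheta G) + entropyQ q (lpRadius q δ₀))) :=
      ((((continuous_entropyQ q).comp (continuous_lpRadius q)).tendsto δ₀).const_add _).mono_left
        nhdsWithin_le_nhds
    refine ge_of_tendsto hcont ?_
    filter_upwards [Ioo_mem_nhdsLT hδ₀] with δ' h
    exact key δ' h.1 (h.2.trans_le (min_le_left _ _)) (h.2.trans_le (min_le_right _ _))
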